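/- All graphs are finite and simple. Definitions. For a graph $G$ and $S\subseteq V(G)$, a \emph{full component} of $S$ is a connected component $A$ of $G-S$ with $N(A)=S$; $S$ is a \emph{minimal separator} if it has at least two full components. A minimal separator $S$ is \emph{subordinate} if there are a minimal separator $S'\supseteq S$ and two distinct full components $A',B'$ of $S'$ such that some full component of $S$ is disjoint from $A'\cup S'\cup B'$. A graph is \emph{mesh} if its complement is not connected. A minimal separator is \emph{mixed} if it is not subordinate and exactly one of its full components induces a mesh graph; it then has exactly two full components, a mesh one $A$ and a non-mesh one $B$. Given a mixed minimal separator $S$ and a set $\widetilde S\subseteq V(G)$, a component of $G-\widetilde S$ is \emph{clarified} if it is disjoint from $A\cup B$. In a rooted forest roots have depth $1$, every vertex is an ancestor of itself, and a path is vertical if one of its ends is an ancestor of the other. For a positive integer $d$, a \emph{treedepth-$d$ structure} in $G$ is a rooted forest $\mathcal T$ with $V(\mathcal T)\subseteq V(G)$, all of whose vertices have depth at most $d$, such that for every edge $uv$ of $G$ with $u,v\in V(\mathcal T)$ one of $u,v$ is an ancestor of the other in $\mathcal T$. It is \emph{maximal} if there is no treedepth-$d$ structure $\mathcal T'$ in $G$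 such that $\mathcal T$ is a proper induced subgraph of $\mathcal T'$ and every root of $\mathcal T$ is a root of $\mathcal T'$. A minimal separator $S$ is \emph{$\mathcal T$-avoiding} if $S\cap V(\mathcal T)$ is contained in a vertical path of $\mathcal T$ and contains no vertex of depth $d$ in $\mathcal T$. Proposition. For each positive integer $d$ there exists a polynomial-time algorithm which takes as input a graph $G$ with no induced path on six vertices and a set $\widetilde S\subseteq V(G)$, and returns a collection $\mathcal S'\subseteq 2^{V(G)}$ such that for every maximal treedepth-$d$ structure $\mathcal T$ in $G$ and every $\mathcal T$-avoiding mixed minimal separator $S$ of $G$ there exists $S'\in\mathcal S'$ such that (i) $\widetilde S\subseteq S'$; (ii) $S'\cap V(\mathcal T)\subseteq S\cup\widetilde S$; and (iii) for each clarified component $\widetilde D$ of $G-\widetilde S$, no connected component of $G[\widetilde D\setminus S']$ intersects more than one connected component of $G-S$. -/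

import Mathlib

/-! ### Graphs: components, minimal separators -/

namespace Carving

variable {V : Type*}

/-- `D` is (the vertex set of) a connected component of the induced subgraph `G[U]`.
With `U = Sᶜ` these are the components of `G - S`. -/
def IsComponentIn (G : SimpleGraph V) (U D : Set V) : Prop :=
  ∃ c : (G.induce U).ConnectedComponent, D = Subtype.val '' c.supp

/-- The open neighbourhood `N(A)` of a set of vertices. -/
def nbhd (G : SimpleGraph V) (A : Set V) : Set V :=
  {v | v ∉ A ∧ ∃ a ∈ A, G.Adj a v}

/-- `A` is a full component (full side) of `S`: a component of `G - S` with `N(A) = S`. -/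
def IsFullComponent (G : SimpleGraph V) (S A : Set V) : Prop :=
  IsComponentIn G Sᶜ A ∧ nbhd G A = S

/-- `S` is a minimal separator: it has at least two full components. -/
def IsMinimalSeparator (G : SimpleGraph V) (S : Set V) : Prop :=
  ∃ A B : Set V, A ≠ B ∧ IsFullComponent G S A ∧ IsFullComponent G S B

/-- The graph `G[A]` is mesh: its complement is not connected. -/
def IsMesh (G : SimpleGraph V) (A : Set V) : Prop :=
  ¬ ((G.induce A)ᶜ).Connected

/-- `S` is a subordinate minimal separator. -/
def IsSubordinate (G : SimpleGraph V) (S : Set V) : Prop :=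
  IsMinimalSeparator G S ∧
    ∃ S' A' B' : Set V, A' ≠ B' ∧ IsFullComponent G S' A' ∧ IsFullComponent G S' B' ∧
      S ⊆ S' ∧ ∃ C : Set V, IsFullComponent G S C ∧ Disjoint C (A' ∪ S' ∪ B')

/-- `S` is a mixed minimal separator: it is not subordinate and exactly one of its full
components is mesh. -/
def IsMixed (G : SimpleGraph V) (S : Set V) : Prop :=
  IsMinimalSeparator G S ∧ ¬ IsSubordinate G S ∧
    ∃! A : Set V, IsFullComponent G S A ∧ IsMesh G A

/-- For a mixed minimal separator `S`, the set `D` is a clarified component of `G - X`: it is a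
component of `G - X` disjoint from `A ∪ B`, where `A` and `B` are the mesh and the non-mesh full
side of `S` (each is unique, since a non-subordinate minimal separator has exactly two full
sides). -/
def IsClarified (G : SimpleGraph V) (S X D : Set V) : Prop :=
  IsComponentIn G Xᶜ D ∧
    ∃ A B : Set V, IsFullComponent G S A ∧ IsMesh G A ∧ IsFullComponent G S B ∧ ¬ IsMesh G B ∧
      Disjoint D (A ∪ B)

/-- `G` has no induced path on six vertices. -/
def IsP6Free (G : SimpleGraph V) : Prop :=
  ¬ (SimpleGraph.pathGraph 6).IsIndContained G

/-! ### Rooted forests and treedepth structures -/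

/-- A rooted forest with vertex set `verts ⊆ V`, given by parent pointers. The depth (roots have
depth 1) is determined on `verts` by the parent pointers, and its existence says that the parent
pointers contain no cycle. Values outside `verts` are irrelevant. -/
structure RootedForest (V : Type*) where
  verts : Set V
  parent : V → Option V
  depth : V → ℕ
  parent_mem : ∀ v ∈ verts, ∀ u, parent v = some u → u ∈ verts
  depth_root : ∀ v ∈ verts, parent v = none → depth v = 1
  depth_child : ∀ v ∈ verts, ∀ u, parent v = some u → depth v = depth u + 1

namespace RootedForest

/-- `v` is a root. -/
def IsRoot (T : RootedForest V) (v : V) : Prop :=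
  v ∈ T.verts ∧ T.parent v = none

/-- `u` and `v` are joined by an edge of the forest. -/
def Adj (T : RootedForest V) (u v : V) : Prop :=
  u ∈ T.verts ∧ v ∈ T.verts ∧ (T.parent u = some v ∨ T.parent v = some u)

/-- `u` is an ancestor of `v`; every vertex is an ancestor of itself. -/
def IsAncestor (T : RootedForest V) (u v : V) : Prop :=
  v ∈ T.verts ∧ Relation.ReflTransGen (fun x y => T.parent x = some y) v u

/-- `u` and `v` are connected by a vertical path. -/
def Comparable (T : RootedForest V) (u v : V) : Prop :=
  T.IsAncestor u v ∨ T.IsAncestor v u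

/-- `P` is the vertex set of a vertical path, that is, of the path between some vertex `w` and an
ancestor `a` of `w`. -/
def IsVerticalPath (T : RootedForest V) (P : Set V) : Prop :=
  ∃ a w : V, T.IsAncestor a w ∧ P = {x | T.IsAncestor a x ∧ T.IsAncestor x w}

/-- `T` is a proper induced subgraph of `T'` and every root of `T` is a root of `T'`. -/
def ProperlyExtendedBy (T T' : RootedForest V) : Prop :=
  T.verts ⊂ T'.verts ∧
    (∀ u ∈ T.verts, ∀ v ∈ T.verts, (T.Adj u v ↔ T'.Adj u v)) ∧
    ∀ v, T.IsRoot v → T'.IsRoot v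

/-- `T` is a treedepth-`d` structure in `G`: it has height at most `d` and is an elimination
forest of the subgraph of `G` induced by its vertices. -/
def IsTreedepthStructure (T : RootedForest V) (G : SimpleGraph V) (d : ℕ) : Prop :=
  (∀ v ∈ T.verts, T.depth v ≤ d) ∧
    ∀ u ∈ T.verts, ∀ v ∈ T.verts, G.Adj u v → T.Comparable u v

/-- `T` is a maximal treedepth-`d` structure in `G`. -/
def IsMaximalTreedepthStructure (T : RootedForest V) (G : SimpleGraph V) (d : ℕ) : Prop :=
  T.IsTreedepthStructure G d ∧
    ¬ ∃ T' : RootedForest V, T'.IsTreedepthStructure G d ∧ T.ProperlyExtendedBy T'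

end RootedForest

/-- The set `S` (a minimal separator) is `T`-avoiding, for a treedepth-`d` structure `T`: `S ∩ T`
is contained in a vertical path of `T` and has no depth-`d` vertex. -/
def IsAvoiding (T : RootedForest V) (d : ℕ) (S : Set V) : Prop :=
  (∃ P : Set V, T.IsVerticalPath P ∧ S ∩ T.verts ⊆ P) ∧
    ∀ v ∈ S ∩ T.verts, T.depth v ≠ d

/-! ### The machine model

A random access machine, programmed by structured (while) programs. The memory consists of
natural-number variables and of two-dimensional arrays of natural numbers, whose cells are
addressed by computed indices. The only arithmetic is addition and truncated subtraction, at unit cost, so that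
numbers with more than polynomially many bits cannot arise in polynomial time. -/

/-- Expressions; `get a i j` reads the cell `(i, j)` of the array `a`. -/
inductive Expr where
  | const (k : ℕ)
  | var (x : ℕ)
  | get (a : ℕ) (i j : Expr)
  | add (e₁ e₂ : Expr)
  | sub (e₁ e₂ : Expr)

/-- The contents of the memory. -/
structure State where
  vars : ℕ → ℕ
  arrs : ℕ → ℕ → ℕ → ℕ

namespace Expr

/-- The value of an expression. -/
def eval (s : State) : Expr → ℕ
  | const k => k
  | var x => s.vars x
  | get a i j => s.arrs a (i.eval s) (j.eval s)
  | add e₁ e₂ => e₁.eval s + e₂.eval s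
  | sub e₁ e₂ => e₁.eval s - e₂.eval s

/-- The number of steps needed to evaluate an expression: one for every operation in it. -/
def cost : Expr → ℕ
  | const _ => 1
  | var _ => 1
  | get _ i j => i.cost + j.cost + 1
  | add e₁ e₂ => e₁.cost + e₂.cost + 1
  | sub e₁ e₂ => e₁.cost + e₂.cost + 1

end Expr

namespace State

/-- Overwrite the variable `x`. -/
def setVar (s : State) (x k : ℕ) : State :=
  { s with vars := fun y => if y = x then k else s.vars y }

/-- Overwrite the cell `(i, j)` of the array `a`. -/
def setArr (s : State) (a i j k : ℕ) : State :=
  { s with arrs := fun a' i' j' => if a' = a ∧ i' = i ∧ j' = j then k else s.arrs a' i' j' }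

end State

/-- Programs; a condition is true when its value is not `0`. -/
inductive Prog where
  | skip
  | assign (x : ℕ) (e : Expr)
  | put (a : ℕ) (i j e : Expr)
  | seq (c₁ c₂ : Prog)
  | cond (e : Expr) (c₁ c₂ : Prog)
  | loop (e : Expr) (c : Prog)

/-- `Exec c s t s'`: the program `c`, started with memory `s`, halts after `t` steps with
memory `s'`. -/
inductive Exec : Prog → State → ℕ → State → Prop where
  | skip (s : State) : Exec Prog.skip s 1 s
  | assign (x : ℕ) (e : Expr) (s : State) :
      Exec (Prog.assign x e) s (e.cost + 1) (s.setVar x (e.eval s))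
  | put (a : ℕ) (i j e : Expr) (s : State) :
      Exec (Prog.put a i j e) s (i.cost + j.cost + e.cost + 1)
        (s.setArr a (i.eval s) (j.eval s) (e.eval s))
  | seq {c₁ c₂ : Prog} {s s' s'' : State} {t t' : ℕ} :
      Exec c₁ s t s' → Exec c₂ s' t' s'' → Exec (Prog.seq c₁ c₂) s (t + t') s''
  | cond_true {e : Expr} {c₁ c₂ : Prog} {s s' : State} {t : ℕ} :
      e.eval s ≠ 0 → Exec c₁ s t s' → Exec (Prog.cond e c₁ c₂) s (e.cost + 1 + t) s'
  | cond_false {e : Expr} {c₁ c₂ : Prog} {s s' : State} {t : ℕ} :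
      e.eval s = 0 → Exec c₂ s t s' → Exec (Prog.cond e c₁ c₂) s (e.cost + 1 + t) s'
  | loop_done {e : Expr} {c : Prog} {s : State} :
      e.eval s = 0 → Exec (Prog.loop e c) s (e.cost + 1) s
  | loop_step {e : Expr} {c : Prog} {s s' s'' : State} {t t' : ℕ} :
      e.eval s ≠ 0 → Exec c s t s' → Exec (Prog.loop e c) s' t' s'' →
      Exec (Prog.loop e c) s (e.cost + 1 + t + t') s''

open Classical in
/-- The initial memory on the input `(G, X)`, where `G` is a graph with vertices `0, …, n - 1` and
`X` is a set of vertices: variable `0` holds `n`, array `0` holds the adjacency matrix of `G`,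
row `0` of array `1` holds the indicator vector of `X`, and everything else is `0`. -/
noncomputable def inputState {n : ℕ} (G : SimpleGraph (Fin n)) (X : Set (Fin n)) : State where
  vars := fun x => if x = 0 then n else 0
  arrs := fun a i j =>
    if (a = 0 ∧ ∃ u v : Fin n, (u : ℕ) = i ∧ (v : ℕ) = j ∧ G.Adj u v) ∨
        (a = 1 ∧ i = 0 ∧ ∃ v : Fin n, (v : ℕ) = j ∧ v ∈ X)
    then 1 else 0

/-- The number of sets in the list that is read off the final memory: the value of variable `1`. -/
def outputLength (s : State) : ℕ := s.vars 1

/-- The family of vertex sets that is read off the final memory: its members are given by the rows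
`0, …, outputLength s - 1` of array `2`, as indicator vectors (non-zero means membership). -/
def outputFamily (n : ℕ) (s : State) : Set (Set (Fin n)) :=
  {X | ∃ i < outputLength s, X = {v : Fin n | s.arrs 2 i (v : ℕ) ≠ 0}}

end Carving

/-! Let `A` and `B` be the mesh and the non-mesh side of `S`, and let `X` be the given set. The set
`S'` consists of `X` and of vertices that a bounded number of chosen vertices certify to lie in `S`.
There are two certificates: a vertex with neighbours in both `A` and `B` lies in `S`, and so does a
vertex outside `A ∪ B` with a neighbour in `A ∪ B`; the latter applies inside components of `G - X`
that miss `A ∪ B`. Hence `S' ⊆ S ∪ X`, which gives (ii) for every forest at once. For (iii) it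
suffices that `S'` contains the frontier: the vertices of `S` with a neighbour outside `S` in the
same clarified component.

Two facts make boundedly many vertices enough. By `IsP6Free.exists_hitting_vertex`, two vertices of
a full side see all frontier vertices except those in a single component of `G - X`. By
`IsP6Free.exists_dominating_pair`, `B` has vertices `p`, `q` such that each vertex of `S` sees `p`
or `q` or is complete to `A`. So a frontier vertex either sees the chosen vertices on both sides, or
lies in one of two exceptional components and sees `a`, `p` or `q`, for any fixed `a ∈ A`.

Components of `G - X` have diameter at most four (`IsP6Free.near_of_conn`), so lying in an
exceptional component is a first-order condition. Thus `S'` is first-order definable from seven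
vertices (`candidate`, `IsP6Free.exists_candidate`), and the algorithm lists the sets given by all
7-tuples. -/

namespace Carving

variable {V : Type*}

/-! ### Connectivity inside a set of vertices -/

/-- `x` and `y` are joined by a walk inside `U` (or are equal). -/
def Conn (G : SimpleGraph V) (U : Set V) (x y : V) : Prop :=
  Relation.ReflTransGen (fun a b => a ∈ U ∧ b ∈ U ∧ G.Adj a b) x y

namespace Conn

variable {G : SimpleGraph V} {U W : Set V} {x y z : V}

theorem symm (h : Conn G U x y) : Conn G U y x := by
  induction h with
  | refl => exact .refl
  | tail _ h ih => exact .head ⟨h.2.1, h.1, h.2.2.symm⟩ ih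

theorem trans (h : Conn G U x y) (h' : Conn G U y z) : Conn G U x z :=
  Relation.ReflTransGen.trans h h'

theorem single (hx : x ∈ U) (hy : y ∈ U) (h : G.Adj x y) : Conn G U x y :=
  Relation.ReflTransGen.single ⟨hx, hy, h⟩

theorem mono (hU : U ⊆ W) (h : Conn G U x y) : Conn G W x y :=
  Relation.ReflTransGen.mono (p := fun a b => a ∈ W ∧ b ∈ W ∧ G.Adj a b)
    (fun _ _ h => ⟨hU h.1, hU h.2.1, h.2.2⟩) _ _ h

theorem mem (h : Conn G U x y) (hx : x ∈ U) : y ∈ U := by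
  induction h with
  | refl => exact hx
  | tail _ h _ => exact h.2.1

/-- A walk that leaves a set `P` has an edge that leaves `P`. -/
theorem exists_exit (h : Conn G U x y) {P : Set V} (hx : x ∈ P) (hy : y ∉ P) :
    ∃ a b, a ∈ P ∧ b ∉ P ∧ a ∈ U ∧ b ∈ U ∧ G.Adj a b := by
  induction h with
  | refl => exact absurd hx hy
  | @tail b c _ h ih =>
    by_cases hb : b ∈ P
    · exact ⟨b, c, hb, hy, h.1, h.2.1, h.2.2⟩
    · exact ih hb

/-- A walk inside `U` runs inside the part of `U` that is connected to its start. -/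
theorem restrict (h : Conn G U x y) : Conn G {z | z ∈ U ∧ Conn G U x z} x y := by
  induction h with
  | refl => exact .refl
  | tail h h' ih =>
    exact ih.tail ⟨⟨h'.1, h⟩, ⟨h'.2.1, Relation.ReflTransGen.tail h h'⟩, h'.2.2⟩

end Conn

theorem induce_reachable_iff {G : SimpleGraph V} {U : Set V} (x y : U) :
    (G.induce U).Reachable x y ↔ Conn G U x y := by
  rw [SimpleGraph.reachable_iff_reflTransGen]
  constructor
  · intro h
    induction h with
    | refl => exact .refl
    | @tail b c _ h ih => exact ih.tail ⟨b.2, c.2, h⟩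
  · intro h
    obtain ⟨x, hx⟩ := x
    obtain ⟨y, hy⟩ := y
    simp only at h
    induction h with
    | refl => exact .refl
    | @tail b c _ h ih => exact (ih h.1).tail h.2.2

/-- Trades components of an induced subgraph for a relation on `V` itself, so that nested vertex
sets can be compared without subtypes. -/
theorem isComponentIn_iff {G : SimpleGraph V} {U D : Set V} :
    IsComponentIn G U D ↔ ∃ x ∈ U, D = {y | y ∈ U ∧ Conn G U x y} := by
  have key : ∀ x : U, Subtype.val '' ((G.induce U).connectedComponentMk x).supp =
      {y | y ∈ U ∧ Conn G U x y} := by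
    intro x
    ext y
    simp only [Set.mem_image, SimpleGraph.ConnectedComponent.mem_supp_iff,
      SimpleGraph.ConnectedComponent.eq, induce_reachable_iff, Subtype.exists, Set.mem_ofPred_eq]
    constructor
    · rintro ⟨z, hz, h, rfl⟩
      exact ⟨hz, h.symm⟩
    · rintro ⟨hy, h⟩
      exact ⟨y, hy, h.symm, rfl⟩
  constructor
  · rintro ⟨c, rfl⟩
    induction c using SimpleGraph.ConnectedComponent.ind with
    | h x => exact ⟨x, x.2, key x⟩
  · rintro ⟨x, hx, rfl⟩
    exact ⟨_, (key ⟨x, hx⟩).symm⟩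

namespace IsComponentIn

variable {G : SimpleGraph V} {U D D' : Set V} {x y : V}

theorem subset (h : IsComponentIn G U D) : D ⊆ U := by
  obtain ⟨x, hx, rfl⟩ := isComponentIn_iff.1 h
  exact fun y hy => hy.1

theorem nonempty (h : IsComponentIn G U D) : D.Nonempty := by
  obtain ⟨x, hx, rfl⟩ := isComponentIn_iff.1 h
  exact ⟨x, hx, .refl⟩

theorem mem_of_conn (h : IsComponentIn G U D) (hx : x ∈ D) (hc : Conn G U x y) : y ∈ D := by
  have hxU := h.subset hx
  obtain ⟨z, hz, rfl⟩ := isComponentIn_iff.1 h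
  exact ⟨hc.mem hxU, hx.2.trans hc⟩

theorem mem_of_adj (h : IsComponentIn G U D) (hx : x ∈ D) (hy : y ∈ U) (hxy : G.Adj x y) :
    y ∈ D :=
  h.mem_of_conn hx (.single (h.subset hx) hy hxy)

theorem conn (h : IsComponentIn G U D) (hx : x ∈ D) (hy : y ∈ D) : Conn G D x y := by
  obtain ⟨z, hz, rfl⟩ := isComponentIn_iff.1 h
  exact hx.2.restrict.symm.trans hy.2.restrict

theorem eq_of_mem (h : IsComponentIn G U D) (h' : IsComponentIn G U D') (hx : x ∈ D)
    (hx' : x ∈ D') : D = D' := by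
  apply Set.Subset.antisymm
  · exact fun y hy => h'.mem_of_conn hx' ((h.conn hx hy).mono h.subset)
  · exact fun y hy => h.mem_of_conn hx ((h'.conn hx' hy).mono h'.subset)

end IsComponentIn

/-! ### Bounded distances in graphs without an induced path on six vertices -/

theorem IsP6Free.false_of_path {G : SimpleGraph V} (hG : IsP6Free G) (f : Fin 6 → V)
    (hf : ∀ i j, i < j → f i ≠ f j ∧ (G.Adj (f i) (f j) ↔ (i : ℕ) + 1 = j)) : False := by
  apply hG
  have hinj : Function.Injective f := by
    intro i j hij
    rcases lt_trichotomy i j with h | h | h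
    · exact absurd hij (hf i j h).1
    · exact h
    · exact absurd hij.symm (hf j i h).1
  refine ⟨⟨⟨f, hinj⟩, ?_⟩⟩
  intro i j
  simp only [Function.Embedding.coeFn_mk, SimpleGraph.pathGraph_adj]
  rcases lt_trichotomy i j with h | h | h
  · rw [(hf i j h).2]
    have : (i : ℕ) < j := h
    omega
  · subst h
    simp
  · rw [G.adj_comm, (hf j i h).2]
    have : (j : ℕ) < i := h
    omega

theorem IsP6Free.false_of_adj {G : SimpleGraph V} (hG : IsP6Free G) {x₀ x₁ x₂ x₃ x₄ x₅ : V}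
    (h01 : G.Adj x₀ x₁) (h12 : G.Adj x₁ x₂) (h23 : G.Adj x₂ x₃) (h34 : G.Adj x₃ x₄)
    (h45 : G.Adj x₄ x₅)
    (h02 : x₀ ≠ x₂ ∧ ¬ G.Adj x₀ x₂) (h03 : x₀ ≠ x₃ ∧ ¬ G.Adj x₀ x₃)
    (h04 : x₀ ≠ x₄ ∧ ¬ G.Adj x₀ x₄) (h05 : x₀ ≠ x₅ ∧ ¬ G.Adj x₀ x₅)
    (h13 : x₁ ≠ x₃ ∧ ¬ G.Adj x₁ x₃) (h14 : x₁ ≠ x₄ ∧ ¬ G.Adj x₁ x₄)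
    (h15 : x₁ ≠ x₅ ∧ ¬ G.Adj x₁ x₅) (h24 : x₂ ≠ x₄ ∧ ¬ G.Adj x₂ x₄)
    (h25 : x₂ ≠ x₅ ∧ ¬ G.Adj x₂ x₅) (h35 : x₃ ≠ x₅ ∧ ¬ G.Adj x₃ x₅) : False := by
  apply hG.false_of_path ![x₀, x₁, x₂, x₃, x₄, x₅]
  intro i j hij
  have := h01.ne
  have := h12.ne
  have := h23.ne
  have := h34.ne
  have := h45.ne
  fin_cases i <;> fin_cases j <;> first | (exact absurd hij (by decide)) | simp [*]

/-- A step inside `W` that moves along an edge or stays. -/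
def Step (G : SimpleGraph V) (W : Set V) (x y : V) : Prop :=
  x ∈ W ∧ y ∈ W ∧ (x = y ∨ G.Adj x y)

/-- `x` and `y` are at distance at most four in `G[W]`. -/
def Near (G : SimpleGraph V) (W : Set V) (x y : V) : Prop :=
  ∃ w₁ w₂ w₃, Step G W x w₁ ∧ Step G W w₁ w₂ ∧ Step G W w₂ w₃ ∧ Step G W w₃ y

theorem Step.conn {G : SimpleGraph V} {W : Set V} {x y : V} (h : Step G W x y) :
    Conn G W x y := by
  obtain ⟨hx, hy, rfl | h⟩ := h
  · exact .refl
  · exact .single hx hy h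

theorem Near.conn {G : SimpleGraph V} {W : Set V} {x y : V} (h : Near G W x y) :
    Conn G W x y := by
  obtain ⟨w₁, w₂, w₃, h₁, h₂, h₃, h₄⟩ := h
  exact ((h₁.conn.trans h₂.conn).trans h₃.conn).trans h₄.conn

/-- Extend a walk by one edge `yz`. If `z` were not within four steps of `x`, then `x, w₁, w₂, w₃,
y, z` would be an induced path, because every coincidence or chord gives a shortcut; stationary
steps pad the shortcuts to length four. -/
theorem IsP6Free.near_of_conn {G : SimpleGraph V} (hG : IsP6Free G) {W : Set V} {x y : V}
    (hx : x ∈ W) (h : Conn G W x y) : Near G W x y := by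
  have hrefl : ∀ z ∈ W, Step G W z z := fun z hz => ⟨hz, hz, .inl rfl⟩
  induction h with
  | refl => exact ⟨x, x, x, hrefl x hx, hrefl x hx, hrefl x hx, hrefl x hx⟩
  | @tail y z _ hyz ih =>
    obtain ⟨w₁, w₂, w₃, h₁, h₂, h₃, h₄⟩ := ih
    obtain ⟨hy, hz, hyz⟩ := hyz
    by_contra hcon
    have hcon : ∀ a b c, Step G W x a → Step G W a b → Step G W b c → Step G W c z → False :=
      fun a b c ha hb hc hd => hcon ⟨a, b, c, ha, hb, hc, hd⟩
    have h₅ : Step G W y z := ⟨hy, hz, .inr hyz⟩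
    have m₁ := h₁.2.1
    have m₂ := h₂.2.1
    have m₃ := h₃.2.1
    have hadj : ∀ {a b}, Step G W a b → a ≠ b → G.Adj a b := fun h hne => h.2.2.resolve_left hne
    have far : ∀ {a b}, a ∈ W → b ∈ W → ¬ Step G W a b → a ≠ b ∧ ¬ G.Adj a b :=
      fun ha hb h => ⟨fun e => h ⟨ha, hb, .inl e⟩, fun e => h ⟨ha, hb, .inr e⟩⟩
    apply hG.false_of_adj (hadj h₁ ?_) (hadj h₂ ?_) (hadj h₃ ?_) (hadj h₄ ?_) hyz
    · exact far hx m₂ fun h => hcon _ _ _ h h₃ h₄ h₅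
    · exact far hx m₃ fun h => hcon _ _ _ h h₄ h₅ (hrefl z hz)
    · exact far hx hy fun h => hcon _ _ _ h h₅ (hrefl z hz) (hrefl z hz)
    · exact far hx hz fun h => hcon _ _ _ h (hrefl z hz) (hrefl z hz) (hrefl z hz)
    · exact far m₁ m₃ fun h => hcon _ _ _ h₁ h h₄ h₅
    · exact far m₁ hy fun h => hcon _ _ _ h₁ h h₅ (hrefl z hz)
    · exact far m₁ hz fun h => hcon _ _ _ h₁ h (hrefl z hz) (hrefl z hz)
    · exact far m₂ hy fun h => hcon _ _ _ h₁ h₂ h h₅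
    · exact far m₂ hz fun h => hcon _ _ _ h₁ h₂ h (hrefl z hz)
    · exact far m₃ hz fun h => hcon _ _ _ h₁ h₂ h₃ h
    · rintro rfl
      exact hcon _ _ _ h₂ h₃ h₄ h₅
    · rintro rfl
      exact hcon _ _ _ h₁ h₃ h₄ h₅
    · rintro rfl
      exact hcon _ _ _ h₁ h₂ h₄ h₅
    · rintro rfl
      exact hcon _ _ _ h₁ h₂ h₃ h₅

/-! ### Modules and non-mesh sides -/

/-- In a connected set `B` that is not mesh there are two vertices, equal or adjacent, such that no
proper subset of `B` containing both is a module of `G[B]`. -/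
theorem exists_pair_not_in_module [Finite V] {G : SimpleGraph V} {B : Set V} (hne : B.Nonempty)
    (hconn : ∀ x ∈ B, ∀ y ∈ B, Conn G B x y) (hB : ¬ IsMesh G B) :
    ∃ p ∈ B, ∃ q ∈ B, (p = q ∨ G.Adj p q) ∧ ∀ K ⊆ B, p ∈ K → q ∈ K → K ≠ B →
      ∃ y ∈ B, y ∉ K ∧ ∃ k ∈ K, ∃ k' ∈ K, G.Adj y k ∧ ¬ G.Adj y k' := by
  by_contra! hcon
  -- The nonempty proper modules of `G[B]`. By `hcon` every vertex and every edge of `G[B]` lies in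
  -- one; `M` is a maximal one.
  let P : Set V → Prop := fun K => K ⊆ B ∧ K ≠ B ∧ K.Nonempty ∧
    ∀ y ∈ B, y ∉ K → ∀ k ∈ K, ∀ k' ∈ K, G.Adj y k → G.Adj y k'
  have hP : ∀ p ∈ B, ∀ q ∈ B, (p = q ∨ G.Adj p q) → ∃ K, P K ∧ p ∈ K ∧ q ∈ K := by
    intro p hp q hq hpq
    obtain ⟨K, h1, h2, h3, h4, h5⟩ := hcon p hp q hq hpq
    exact ⟨K, ⟨h1, h4, ⟨p, h2⟩, h5⟩, h2, h3⟩
  obtain ⟨b, hb⟩ := hne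
  obtain ⟨K₀, hK₀, -⟩ := hP b hb b hb (.inl rfl)
  obtain ⟨M, hM⟩ := (Set.toFinite {K | P K}).exists_maximal ⟨K₀, hK₀⟩
  obtain ⟨⟨hMB, hMne, ⟨m₀, hm₀⟩, hMmod⟩, hmax⟩ := hM
  obtain ⟨x₀, hx₀, hx₀M⟩ : ∃ x ∈ B, x ∉ M := by
    by_contra! h
    exact hMne (hMB.antisymm h)
  obtain ⟨m, x, hm, hx, hmB, hxB, hmx⟩ := (hconn m₀ (hMB hm₀) x₀ hx₀).exists_exit hm₀ hx₀M
  obtain ⟨M', ⟨hMB', hMne', -, hMmod'⟩, hm', hx'⟩ := hP m hmB x hxB (.inr hmx)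
  have hunion : M ∪ M' = B := by
    by_contra hne
    -- Overlapping modules have a module as their union, so a proper union would contradict the
    -- maximality of `M`.
    refine hx (hmax (y := M ∪ M') ⟨Set.union_subset hMB hMB', hne, ⟨m, .inl hm⟩, ?_⟩
      Set.subset_union_left (.inr hx'))
    intro y hy hyM k hk k' hk' hyk
    have hyM₁ : y ∉ M := fun h => hyM (.inl h)
    have hyM₂ : y ∉ M' := fun h => hyM (.inr h)
    have hym : G.Adj y m := by
      rcases hk with hk | hk
      · exact hMmod y hy hyM₁ k hk m hm hyk
      · exact hMmod' y hy hyM₂ k hk m hm' hyk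
    rcases hk' with hk' | hk'
    · exact hMmod y hy hyM₁ m hm k' hk' hym
    · exact hMmod' y hy hyM₂ m hm' k' hk' hym
  have hout : ∀ y ∈ B, y ∉ M → y ∈ M' := by
    intro y hy hyM
    rw [← hunion] at hy
    exact hy.resolve_left hyM
  obtain ⟨z, hzB, hz'⟩ : ∃ z ∈ B, z ∉ M' := by
    by_contra! h
    exact hMne' (hMB'.antisymm h)
  have hz : z ∈ M := by
    by_contra h
    exact hz' (hout z hzB h)
  have hxz : G.Adj x z := hMmod x hxB hx m hm z hz hmx.symm
  -- Since `M'` is a module containing `x` and all of `B \ M`, the vertex `z` outside it sees all of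
  -- `B \ M`; then so does all of `M`. The complement of `G[B]` is therefore disconnected.
  have hcomplete : ∀ y ∈ B, y ∉ M → ∀ k ∈ M, G.Adj y k := by
    intro y hy hyM k hk
    have hzy := hMmod' z hzB hz' x hx' y (hout y hy hyM) hxz.symm
    exact hMmod y hy hyM z hz k hk hzy.symm
  apply hB
  intro hc
  have hreach := hc.preconnected ⟨m, hmB⟩ ⟨x, hxB⟩
  rw [SimpleGraph.reachable_iff_reflTransGen] at hreach
  have : ∀ y : B, Relation.ReflTransGen ((G.induce B)ᶜ).Adj ⟨m, hmB⟩ y → (y : V) ∈ M := by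
    intro y hy
    induction hy with
    | refl => exact hm
    | @tail u w _ huw ih =>
      by_contra hw
      exact huw.2 (hcomplete w w.2 hw u ih).symm
  exact hx (this _ hreach)

/-! ### Full sides and a dominating pair in a non-mesh side -/

namespace IsFullComponent

variable {G : SimpleGraph V} {S A B : Set V}

theorem notMem_sep (h : IsFullComponent G S A) {x : V} (hx : x ∈ A) : x ∉ S :=
  h.1.subset hx

theorem exists_adj (h : IsFullComponent G S A) {v : V} (hv : v ∈ S) : ∃ a ∈ A, G.Adj v a := by
  rw [← h.2] at hv
  obtain ⟨-, a, ha, hav⟩ := hv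
  exact ⟨a, ha, hav.symm⟩

theorem mem_or_mem (h : IsFullComponent G S A) {x y : V} (hx : x ∈ A) (hxy : G.Adj y x) :
    y ∈ S ∨ y ∈ A := by
  by_cases hy : y ∈ S
  · exact .inl hy
  · exact .inr (h.1.mem_of_adj hx hy hxy.symm)

theorem conn (h : IsFullComponent G S A) {x y : V} (hx : x ∈ A) (hy : y ∈ A) : Conn G A x y :=
  h.1.conn hx hy

theorem not_adj (hA : IsFullComponent G S A) (hB : IsFullComponent G S B) (hAB : A ≠ B)
    {x y : V} (hx : x ∈ A) (hy : y ∈ B) : x ≠ y ∧ ¬ G.Adj x y := by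
  constructor
  · rintro rfl
    exact hAB (hA.1.eq_of_mem hB.1 hx hy)
  · intro h
    exact hAB (hA.1.eq_of_mem hB.1 (hA.1.mem_of_adj hx (hB.1.subset hy) h) hy)

end IsFullComponent

/-- Every vertex of `S` is adjacent to one of two suitable vertices of a non-mesh full side, or
complete to every other full side. -/
theorem IsP6Free.exists_dominating_pair [Finite V] {G : SimpleGraph V} (hG : IsP6Free G)
    {S A B : Set V} (hA : IsFullComponent G S A) (hB : IsFullComponent G S B) (hAB : A ≠ B)
    (hmesh : ¬ IsMesh G B) :
    ∃ p ∈ B, ∃ q ∈ B, ∀ v ∈ S, G.Adj v p ∨ G.Adj v q ∨ ∀ a ∈ A, G.Adj v a := by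
  obtain ⟨p, hp, q, hq, hpq, hmod⟩ :=
    exists_pair_not_in_module hB.1.nonempty (fun x hx y hy => hB.conn hx hy) hmesh
  refine ⟨p, hp, q, hq, fun v hv => ?_⟩
  by_contra! hcon
  obtain ⟨hvp, hvq, a', ha', hva'⟩ := hcon
  obtain ⟨b₀, hb₀, hvb₀⟩ := hB.exists_adj hv
  let U : Set V := {x | x ∈ B ∧ ¬ G.Adj v x}
  have hpU : p ∈ U := ⟨hp, hvp⟩
  -- This component of `B \ N(v)` contains `p` and `q`, so it is not a module; a vertex `b₁`
  -- distinguishing two of its vertices must be adjacent to `v`.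
  let K : Set V := {x | x ∈ U ∧ Conn G U p x}
  have hK : IsComponentIn G U K := isComponentIn_iff.2 ⟨p, hpU, rfl⟩
  have hpK : p ∈ K := ⟨hpU, .refl⟩
  have hqK : q ∈ K := by
    rcases hpq with rfl | h
    · exact hpK
    · exact hK.mem_of_adj hpK ⟨hq, hvq⟩ h
  obtain ⟨b₁, hb₁, hb₁K, k, hk, k', hk', hbk, hbk'⟩ := hmod K (fun x hx => hx.1.1) hpK hqK
    (fun h => (h ▸ hb₀ : b₀ ∈ K).1.2 hvb₀)
  have hvb₁ : G.Adj v b₁ := by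
    by_contra h
    exact hb₁K (hK.mem_of_adj hk ⟨hb₁, h⟩ hbk.symm)
  obtain ⟨b₂, b₃, hb₂, hb₃, hb₂K, hb₃K, hb₂₃⟩ :=
    (hK.conn hk hk').exists_exit (P := {x | G.Adj b₁ x}) hbk hbk'
  obtain ⟨a₀, ha₀, hva₀⟩ := hA.exists_adj hv
  obtain ⟨a, a₁, hva, hva₁, ha, ha₁, haa₁⟩ :=
    (hA.conn ha₀ ha').exists_exit (P := {x | G.Adj v x}) hva₀ hva'
  have hSA : ∀ x ∈ A, x ≠ v := fun x hx h => hA.notMem_sep hx (h ▸ hv)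
  have hSB : ∀ x ∈ B, x ≠ v := fun x hx h => hB.notMem_sep hx (h ▸ hv)
  have hBA : ∀ x ∈ B, ∀ y ∈ A, x ≠ y ∧ ¬ G.Adj x y := fun x hx y hy =>
    hB.not_adj hA hAB.symm hx hy
  have hb₂B : b₂ ∈ B := hb₂K.1.1
  have hb₃B : b₃ ∈ B := hb₃K.1.1
  -- The induced path is `b₃, b₂, b₁, v, a, a₁`.
  refine hG.false_of_adj hb₂₃.symm (G.adj_symm hb₂) hvb₁.symm hva haa₁
    ⟨?_, fun h => hb₃ h.symm⟩ ⟨hSB _ hb₃B, fun h => hb₃K.1.2 h.symm⟩ (hBA _ hb₃B _ ha)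
    (hBA _ hb₃B _ ha₁) ⟨hSB _ hb₂B, fun h => hb₂K.1.2 h.symm⟩ (hBA _ hb₂B _ ha)
    (hBA _ hb₂B _ ha₁) (hBA _ hb₁ _ ha) (hBA _ hb₁ _ ha₁) ⟨(hSA _ ha₁).symm, hva₁⟩
  rintro rfl
  exact hb₁K hb₃K

/-! ### Hitting the relevant vertices of the separator -/

/-- Let `B` be connected and let `R` be a set of vertices with neighbours in `B`, none of them
adjacent to `p ∈ B`. If unrelated vertices of `R` with neighbours in a common connected subset of
`B` also have a common neighbour there, then some vertex of `B` is adjacent to all vertices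
of `R` unrelated to some fixed vertex of `R`. -/
theorem exists_common_neighbour [Finite V] {G : SimpleGraph V} {B R : Set V}
    {r : V → V → Prop} {p : V} (hp : p ∈ B) (hconn : ∀ y ∈ B, Conn G B p y) (hR : R.Nonempty)
    (hadj : ∀ v ∈ R, ∃ y ∈ B, G.Adj v y) (hRp : ∀ v ∈ R, ¬ G.Adj v p)
    (hcommon : ∀ v ∈ R, ∀ w ∈ R, ¬ r v w → ∀ C ⊆ B,
      (∀ x ∈ C, ∀ y ∈ C, Conn G C x y) → (∃ x ∈ C, G.Adj v x) → (∃ x ∈ C, G.Adj w x) →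
      ∃ x ∈ C, G.Adj v x ∧ G.Adj w x) :
    ∃ x ∈ R, ∃ b ∈ B, ∀ v ∈ R, r x v ∨ G.Adj v b := by
  let C : V → Set V := fun v => {y | Conn G {z | z ∈ B ∧ ¬ G.Adj v z} p y}
  -- Choose `x` so that the component of `p` in `B \ N(x)` is largest, and let `b` be a neighbour of
  -- `x` just outside it.
  obtain ⟨x, hxR, hmax⟩ := Set.exists_max_image R (fun v => (C v).ncard) (Set.toFinite R) hR
  obtain ⟨y, hyB, hxy⟩ := hadj x hxR
  have hpx : p ∈ {z | z ∈ B ∧ ¬ G.Adj x z} := ⟨hp, hRp x hxR⟩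
  obtain ⟨c, b, hc, hb, hcB, hbB, hcb⟩ := (hconn y hyB).exists_exit (P := C x)
    Relation.ReflTransGen.refl (fun h => (Conn.mem h hpx).2 hxy)
  have hcx : c ∈ {z | z ∈ B ∧ ¬ G.Adj x z} := Conn.mem hc hpx
  have hxb : G.Adj x b := by
    by_contra h
    exact hb (hc.trans (.single hcx ⟨hbB, h⟩ hcb))
  refine ⟨x, hxR, b, hbB, fun v hv => ?_⟩
  by_contra! hcon
  obtain ⟨hxv, hvb⟩ := hcon
  -- Delete only the common neighbours of `x` and `v`. The component `K` of `p` contains `C x` and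
  -- also `b`. A neighbour of `v` in `K` would force a common neighbour there, so `K ⊆ C v`, against
  -- the choice of `x`.
  let U : Set V := {z | z ∈ B ∧ ¬ (G.Adj x z ∧ G.Adj v z)}
  have hpU : p ∈ U := ⟨hp, fun h => hRp x hxR h.1⟩
  let K : Set V := {y | y ∈ U ∧ Conn G U p y}
  have hK : IsComponentIn G U K := isComponentIn_iff.2 ⟨p, hpU, rfl⟩
  have hpK : p ∈ K := ⟨hpU, .refl⟩
  have hCK : C x ⊆ K := fun y hy => hK.mem_of_conn hpK
    (Conn.mono (fun z hz => ⟨hz.1, fun h => hz.2 h.1⟩) hy)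
  have hbK : b ∈ K := hK.mem_of_adj (hCK hc) ⟨hbB, fun h => hvb h.2⟩ hcb
  have hKv : ∀ y ∈ K, ¬ G.Adj v y := by
    intro y hy hvy
    obtain ⟨z, hz, h⟩ := hcommon x hxR v hv hxv K (fun z hz => hz.1.1)
      (fun _ h _ h' => hK.conn h h') ⟨b, hbK, hxb⟩ ⟨y, hy, hvy⟩
    exact hz.1.2 h
  have hKC : K ⊆ C v := fun y hy =>
    Conn.mono (fun z hz => ⟨hz.1.1, hKv z hz⟩) (hK.conn hpK hy)
  have hlt : (C x).ncard < (C v).ncard :=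
    Set.ncard_lt_ncard ⟨hCK.trans hKC, fun h => hb (h (hKC hbK))⟩ (Set.toFinite _)
  exact absurd (hmax v hv) (not_le.2 hlt)

/-- Two vertices outside `B` that have private neighbours outside `B`, with no adjacencies between
the two resulting edges, share a neighbour in every connected subset of `B` that meets both
neighbourhoods. -/
theorem IsP6Free.exists_shared_neighbour {G : SimpleGraph V} (hG : IsP6Free G) {C : Set V}
    {u v v' u' : V} (huv : G.Adj u v) (huv' : G.Adj u' v')
    (h₁ : u ≠ u' ∧ ¬ G.Adj u u') (h₂ : u ≠ v' ∧ ¬ G.Adj u v') (h₃ : v ≠ u' ∧ ¬ G.Adj v u')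
    (h₄ : v ≠ v' ∧ ¬ G.Adj v v') (hu : u ∉ C ∧ ∀ c ∈ C, ¬ G.Adj u c)
    (hu' : u' ∉ C ∧ ∀ c ∈ C, ¬ G.Adj u' c) (hv : v ∉ C) (hv' : v' ∉ C)
    (hC : ∀ x ∈ C, ∀ y ∈ C, Conn G C x y) (hvC : ∃ x ∈ C, G.Adj v x)
    (hvC' : ∃ x ∈ C, G.Adj v' x) : ∃ x ∈ C, G.Adj v x ∧ G.Adj v' x := by
  by_contra! hno
  obtain ⟨c, hc, hvc⟩ := hvC
  obtain ⟨c', hc', hvc'⟩ := hvC'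
  let W : Set V := {u, v, v', u'} ∪ C
  have hCW : C ⊆ W := Set.subset_union_right
  have hWu : u ∈ W := by simp [W]
  have hWv : v ∈ W := by simp [W]
  have hWv' : v' ∈ W := by simp [W]
  have hWu' : u' ∈ W := by simp [W]
  have hconn : Conn G W u u' :=
    ((((Conn.single hWu hWv huv).trans (.single hWv (hCW hc) hvc)).trans
      ((hC c hc c' hc').mono hCW)).trans (.single (hCW hc') hWv' hvc'.symm)).trans
      (.single hWv' hWu' huv'.symm)
  -- A walk from `u` to `u'` in `W` has to pass through `v` and `v'`. With only four steps, its
  -- midpoint must be a common neighbour of `v` and `v'` in `C`.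
  obtain ⟨w₁, w₂, w₃, s₁, s₂, s₃, s₄⟩ := hG.near_of_conn hWu hconn
  have cases : ∀ {x}, x ∈ W → x = u ∨ x = v ∨ x = v' ∨ x = u' ∨ x ∈ C := by
    intro x hx
    simpa [W, or_assoc] using hx
  have e₁ : w₁ = u ∨ w₁ = v := by
    rcases s₁.2.2 with h | h
    · exact .inl h.symm
    · rcases cases s₁.2.1 with h' | h' | h' | h' | h'
      · exact .inl h'
      · exact .inr h'
      · exact absurd (h' ▸ h) h₂.2
      · exact absurd (h' ▸ h) h₁.2
      · exact absurd h (hu.2 _ h')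
  have e₃ : w₃ = u' ∨ w₃ = v' := by
    rcases s₄.2.2 with h | h
    · exact .inl h
    · rcases cases s₄.1 with h' | h' | h' | h' | h'
      · exact absurd (h' ▸ h) h₁.2
      · exact absurd (h' ▸ h) h₃.2
      · exact .inr h'
      · exact .inl h'
      · exact absurd h.symm (hu'.2 _ h')
  have l : w₂ = u ∨ w₂ = v ∨ (w₂ ∈ C ∧ G.Adj v w₂) := by
    have := s₂.2.2
    have := cases s₂.2.1
    have := G.adj_comm
    grind
  have l' : w₂ = u' ∨ w₂ = v' ∨ (w₂ ∈ C ∧ G.Adj v' w₂) := by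
    have := s₃.2.2
    have := cases s₂.2.1
    have := G.adj_comm
    grind
  grind

/-- The vertices of `S` that have a neighbour outside `S` in their component of `G - X`, where this
component is disjoint from `F`. -/
def frontier (G : SimpleGraph V) (S X F : Set V) : Set V :=
  {v | v ∈ S ∧ ∃ D, IsComponentIn G Xᶜ D ∧ Disjoint D F ∧ v ∈ D ∧ ∃ u ∈ D, u ∉ S ∧ G.Adj u v}

/-- Apply `exists_common_neighbour` to the frontier vertices missed by `p`, calling two of them
related when they lie in the same component of `G - X`. Unrelated ones have neighbours outside `S`
in different components, which supply the private edges that `IsP6Free.exists_shared_neighbour`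
needs. -/
theorem IsP6Free.exists_hitting_vertex [Finite V] {G : SimpleGraph V} (hG : IsP6Free G)
    {S X F B : Set V} (hB : IsFullComponent G S B) (hBF : B ⊆ F) {p : V} (hp : p ∈ B) :
    ∃ b ∈ B, (∀ v ∈ frontier G S X F, G.Adj v p ∨ G.Adj v b) ∨
      ∃ x ∈ frontier G S X F, ∀ v ∈ frontier G S X F,
        G.Adj v p ∨ G.Adj v b ∨ Conn G Xᶜ x v := by
  let R : Set V := {v | v ∈ frontier G S X F ∧ ¬ G.Adj v p}
  rcases R.eq_empty_or_nonempty with hR | hR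
  · refine ⟨p, hp, .inl fun v hv => ?_⟩
    by_contra! h
    have : v ∈ R := ⟨hv, h.1⟩
    simp [hR] at this
  · have hcommon : ∀ v ∈ R, ∀ w ∈ R, ¬ Conn G Xᶜ v w → ∀ C ⊆ B,
        (∀ x ∈ C, ∀ y ∈ C, Conn G C x y) → (∃ x ∈ C, G.Adj v x) → (∃ x ∈ C, G.Adj w x) →
        ∃ x ∈ C, G.Adj v x ∧ G.Adj w x := by
      rintro v ⟨⟨hvS, D, hD, hDF, hvD, u, huD, huS, huv⟩, -⟩
        v' ⟨⟨hvS', D', hD', hDF', hvD', u', huD', huS', huv'⟩, -⟩ hne C hCB hC hvC hvC'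
      have hfar : ∀ y ∈ D, ∀ z ∈ D', y ≠ z ∧ ¬ G.Adj y z := by
        intro y hy z hz
        have hzD : z ∉ D := by
          intro h
          have := hD.eq_of_mem hD' h hz
          subst this
          exact hne ((hD.conn hvD hvD').mono hD.subset)
        exact ⟨fun h => hzD (h ▸ hy), fun h => hzD (hD.mem_of_adj hy (hD'.subset hz) h)⟩
      have hsep : ∀ {E : Set V} {y : V}, Disjoint E F → y ∈ E → y ∉ S →
          y ∉ C ∧ ∀ c ∈ C, ¬ G.Adj y c := by
        intro E y hEF hy hyS
        have hyB : y ∉ B := fun h => Set.disjoint_left.1 hEF hy (hBF h)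
        exact ⟨fun h => hyB (hCB h), fun c hc h => (hB.mem_or_mem (hCB hc) h).elim hyS hyB⟩
      exact hG.exists_shared_neighbour huv huv' (hfar u huD u' huD') (hfar u huD v' hvD')
        (hfar v hvD u' huD') (hfar v hvD v' hvD') (hsep hDF huD huS) (hsep hDF' huD' huS')
        (fun h => hB.notMem_sep (hCB h) hvS) (fun h => hB.notMem_sep (hCB h) hvS') hC hvC hvC'
    obtain ⟨x, hx, b, hb, h⟩ := exists_common_neighbour (r := Conn G Xᶜ) hp
      (fun y hy => hB.conn hp hy) hR (fun v hv => hB.exists_adj hv.1.1) (fun v hv => hv.2) hcommon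
    refine ⟨b, hb, .inr ⟨x, hx.1, fun v hv => ?_⟩⟩
    by_cases hvp : G.Adj v p
    · exact .inl hvp
    · exact .inr (h v ⟨hv, hvp⟩).symm

/-! ### The candidate sets -/

/-- The candidate determined by seven vertices. The case `eᵢ = a` means that `eᵢ` is not used. -/
def candidate (G : SimpleGraph V) (X : Set V) (a a' p q b e₁ e₂ : V) : Set V :=
  {v | v ∈ X ∨ ((G.Adj v a ∨ G.Adj v a') ∧ (G.Adj v p ∨ G.Adj v b)) ∨
    ((e₁ ≠ a ∧ Near G Xᶜ e₁ v ∨ e₂ ≠ a ∧ Near G Xᶜ e₂ v) ∧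
      (G.Adj v a ∨ G.Adj v p ∨ G.Adj v q))}

/-- A mixed minimal separator has precisely one mesh and one non-mesh full side. -/
theorem IsMixed.exists_sides {G : SimpleGraph V} {S : Set V} (hS : IsMixed G S) :
    ∃ A B : Set V, A ≠ B ∧ IsFullComponent G S A ∧ IsFullComponent G S B ∧ ¬ IsMesh G B ∧
      ∀ A' B', IsFullComponent G S A' → IsMesh G A' → IsFullComponent G S B' → ¬ IsMesh G B' →
        A' = A ∧ B' = B := by
  obtain ⟨hmin, hsub, A, ⟨hA, hAm⟩, huniq⟩ := hS
  obtain ⟨B, hB, hAB⟩ : ∃ B, IsFullComponent G S B ∧ A ≠ B := by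
    obtain ⟨A₁, B₁, hne, hA₁, hB₁⟩ := hmin
    by_cases h : A = A₁
    · exact ⟨B₁, hB₁, h ▸ hne⟩
    · exact ⟨A₁, hA₁, h⟩
  refine ⟨A, B, hAB, hA, hB, fun h => hAB (huniq B ⟨hB, h⟩).symm, ?_⟩
  intro A' B' hA' hAm' hB' hBm'
  refine ⟨huniq A' ⟨hA', hAm'⟩, ?_⟩
  by_contra hne
  have hne' : B' ≠ A := by
    rintro rfl
    exact hBm' hAm
  -- A third full side would make `S` subordinate, witnessed by `S` itself.
  refine hsub ⟨hmin, S, A, B, hAB, hA, hB, subset_rfl, B', hB', ?_⟩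
  rw [Set.disjoint_left]
  rintro x hx ((h | h) | h)
  · exact hne' (hB'.1.eq_of_mem hA.1 hx h)
  · exact hB'.notMem_sep hx h
  · exact hne (hB'.1.eq_of_mem hB.1 hx h)

/-- Some candidate is contained in `S ∪ X` and separates the components of `G - S` inside every
clarified component of `G - X`. This holds regardless of any treedepth structure. -/
theorem IsP6Free.exists_candidate [Finite V] {G : SimpleGraph V} (hG : IsP6Free G) (X : Set V)
    {S : Set V} (hS : IsMixed G S) :
    ∃ a a' p q b e₁ e₂ : V, candidate G X a a' p q b e₁ e₂ ⊆ S ∪ X ∧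
      ∀ D, IsClarified G S X D →
      ∀ C, IsComponentIn G (D \ candidate G X a a' p q b e₁ e₂) C →
      ∀ D₁ D₂, IsComponentIn G Sᶜ D₁ → IsComponentIn G Sᶜ D₂ →
        (C ∩ D₁).Nonempty → (C ∩ D₂).Nonempty → D₁ = D₂ := by
  obtain ⟨A, B, hAB, hA, hB, hmesh, huniq⟩ := hS.exists_sides
  obtain ⟨p, hp, q, hq, hdom⟩ := hG.exists_dominating_pair hA hB hAB hmesh
  obtain ⟨a, ha⟩ := hA.1.nonempty
  obtain ⟨a', ha', hhitA⟩ := hG.exists_hitting_vertex (X := X) hA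
    (Set.subset_union_left (t := B)) ha
  obtain ⟨b, hb, hhitB⟩ := hG.exists_hitting_vertex (X := X) hB
    (Set.subset_union_right (s := A)) hp
  have hmem : ∀ v ∈ frontier G S X (A ∪ B), v ∈ Xᶜ ∧ v ≠ a := by
    rintro v ⟨hv, D, hD, -, hvD, -⟩
    exact ⟨hD.subset hvD, fun h => hA.notMem_sep ha (h ▸ hv)⟩
  -- The vertex `a` serves as the dummy value of `e`: it lies in `A`, so it is never a frontier
  -- vertex.
  have hlift : ∀ {y z : V}, (∀ v ∈ frontier G S X (A ∪ B), G.Adj v y ∨ G.Adj v z) ∨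
      (∃ x ∈ frontier G S X (A ∪ B), ∀ v ∈ frontier G S X (A ∪ B),
        G.Adj v y ∨ G.Adj v z ∨ Conn G Xᶜ x v) →
      ∃ e, (e = a ∨ e ∈ frontier G S X (A ∪ B)) ∧ ∀ v ∈ frontier G S X (A ∪ B),
        (G.Adj v y ∨ G.Adj v z) ∨ e ≠ a ∧ Near G Xᶜ e v := by
    rintro y z (h | ⟨x, hx, h⟩)
    · exact ⟨a, .inl rfl, fun v hv => .inl (h v hv)⟩
    · refine ⟨x, .inr hx, fun v hv => ?_⟩
      rcases h v hv with h | h | h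
      · exact .inl (.inl h)
      · exact .inl (.inr h)
      · exact .inr ⟨(hmem x hx).2, hG.near_of_conn (hmem x hx).1 h⟩
  obtain ⟨e₁, he₁, hhit₁⟩ := hlift hhitA
  obtain ⟨e₂, he₂, hhit₂⟩ := hlift hhitB
  refine ⟨a, a', p, q, b, e₁, e₂, ?_, ?_⟩
  · rintro v (hv | ⟨hva, hvb⟩ | ⟨hve, hv⟩)
    · exact .inr hv
    · left
      by_contra hvS
      have hvA : v ∈ A := by
        rcases hva with h | h
        · exact (hA.mem_or_mem ha h).resolve_left hvS
        · exact (hA.mem_or_mem ha' h).resolve_left hvS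
      have hvB : v ∈ B := by
        rcases hvb with h | h
        · exact (hB.mem_or_mem hp h).resolve_left hvS
        · exact (hB.mem_or_mem hb h).resolve_left hvS
      exact (hA.not_adj hB hAB hvA hvB).1 rfl
    · left
      have hout : ∀ e, (e = a ∨ e ∈ frontier G S X (A ∪ B)) → e ≠ a → Near G Xᶜ e v →
          v ∉ A ∪ B := by
        rintro e (he | ⟨-, D, hD, hDF, heD, -⟩) hne hnear
        · exact absurd he hne
        · exact Set.disjoint_left.1 hDF (hD.mem_of_conn heD hnear.conn)
      have hvAB : v ∉ A ∪ B := by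
        rcases hve with ⟨hne, h⟩ | ⟨hne, h⟩
        · exact hout e₁ he₁ hne h
        · exact hout e₂ he₂ hne h
      rcases hv with h | h | h
      · exact (hA.mem_or_mem ha h).resolve_right fun h' => hvAB (.inl h')
      · exact (hB.mem_or_mem hp h).resolve_right fun h' => hvAB (.inr h')
      · exact (hB.mem_or_mem hq h).resolve_right fun h' => hvAB (.inr h')
  · rintro D ⟨hD, A', B', hA', hAm', hB', hBm', hdisj⟩ C hC D₁ D₂ hD₁ hD₂ ⟨x, hxC, hx⟩
      ⟨y, hyC, hy⟩
    obtain ⟨rfl, rfl⟩ := huniq A' B' hA' hAm' hB' hBm'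
    by_contra hne
    have hyD₁ : y ∉ D₁ := fun h => hne (hD₁.eq_of_mem hD₂ h hy)
    -- A connected set meeting two components of `G - S` must leave the first one through `S`; the
    -- exit vertex is a frontier vertex, hence belongs to the candidate, from which `C` is disjoint.
    obtain ⟨u, v, hu, hv, huC, hvC, huv⟩ := (hC.conn hxC hyC).exists_exit hx hyD₁
    have hvS : v ∈ S := by
      by_contra h
      exact hv (hD₁.mem_of_adj hu h huv)
    have hvfr : v ∈ frontier G S X (A' ∪ B') :=
      ⟨hvS, D, hD, hdisj, (hC.subset hvC).1, u, (hC.subset huC).1, hD₁.subset hu, huv⟩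
    have hvapq : G.Adj v a ∨ G.Adj v p ∨ G.Adj v q := by
      rcases hdom v hvS with h | h | h
      · exact .inr (.inl h)
      · exact .inr (.inr h)
      · exact .inl (h a ha)
    apply (hC.subset hvC).2
    rcases hhit₁ v hvfr with h₁ | h₁
    · rcases hhit₂ v hvfr with h₂ | h₂
      · exact .inr (.inl ⟨h₁, h₂⟩)
      · exact .inr (.inr ⟨.inr h₂, hvapq⟩)
    · exact .inr (.inr ⟨.inl h₁, hvapq⟩)

end Carving

/-! ### From first-order definitions to polynomial-time programs -/

namespace Carving

/-! ### Programs that decide first-order properties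

Variable `0` holds the number `n` of vertices and variable `1` the length of the output. Variable
`2` receives the results of tests, and the variables `3, 4, …` hold the values of a tuple. -/

/-- The memory still contains the input. -/
def HasInput {n : ℕ} (G : SimpleGraph (Fin n)) (X : Set (Fin n)) (s : State) : Prop :=
  s.vars 0 = n ∧ s.arrs 0 = (inputState G X).arrs 0 ∧ s.arrs 1 = (inputState G X).arrs 1

/-- The first `k` entries of the stored tuple. -/
def State.tuple (s : State) (k : ℕ) : Fin k → ℕ := fun i => s.vars (3 + i)

/-- Properties of `k`-tuples of natural numbers, depending on a graph and a set of vertices. -/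
abbrev Query (k : ℕ) : Type :=
  ∀ n : ℕ, SimpleGraph (Fin n) → Set (Fin n) → (Fin k → ℕ) → Prop

/-- Some program decides `P` in polynomial time, without changing anything that matters. -/
def Tests {k : ℕ} (P : Query k) : Prop :=
  ∃ (c : Prog) (p : Polynomial ℕ), ∀ (n : ℕ) (G : SimpleGraph (Fin n)) (X : Set (Fin n))
    (s : State), HasInput G X s → ∃ t s', Exec c s t s' ∧ t ≤ p.eval n ∧ s'.arrs = s.arrs ∧
      (∀ y < 3 + k, y ≠ 2 → s'.vars y = s.vars y) ∧ (s'.vars 2 ≠ 0 ↔ P n G X (s.tuple k))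

theorem HasInput.of_eq {n : ℕ} {G : SimpleGraph (Fin n)} {X : Set (Fin n)} {s s' : State}
    (h : HasInput G X s) (h₀ : s'.vars 0 = s.vars 0) (h₁ : s'.arrs 0 = s.arrs 0)
    (h₂ : s'.arrs 1 = s.arrs 1) : HasInput G X s' :=
  ⟨h₀.trans h.1, h₁.trans h.2.1, h₂.trans h.2.2⟩

theorem State.tuple_congr {k : ℕ} {s s' : State} (h : ∀ y < 3 + k, y ≠ 2 → s'.vars y = s.vars y) :
    s'.tuple k = s.tuple k :=
  funext fun i => h _ (by omega) (by omega)

/-- A loop whose body runs `N` times. -/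
theorem exec_loop {e : Expr} {c : Prog} {T N : ℕ} (I : ℕ → State → Prop)
    (hstep : ∀ i < N, ∀ s, I i s → e.eval s ≠ 0 ∧ ∃ t s', Exec c s t s' ∧ t ≤ T ∧ I (i + 1) s')
    (hdone : ∀ s, I N s → e.eval s = 0) {s : State} (hs : I 0 s) :
    ∃ t s', Exec (.loop e c) s t s' ∧ t ≤ N * (e.cost + 1 + T) + (e.cost + 1) ∧ I N s' := by
  have key : ∀ m i, i + m = N → ∀ s, I i s →
      ∃ t s', Exec (.loop e c) s t s' ∧ t ≤ m * (e.cost + 1 + T) + (e.cost + 1) ∧ I N s' := by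
    intro m
    induction m with
    | zero =>
      rintro i rfl s hs
      exact ⟨_, s, .loop_done (hdone s hs), by simp, hs⟩
    | succ m ih =>
      intro i hi s hs
      obtain ⟨he, t, s', hex, ht, hs'⟩ := hstep i (by omega) s hs
      obtain ⟨t', s'', hex', ht', hs''⟩ := ih (i + 1) (by omega) s' hs'
      refine ⟨_, s'', .loop_step he hex hex', ?_, hs''⟩
      rw [Nat.succ_mul]
      omega
  exact key N 0 (by omega) s hs

theorem tests_expr {k : ℕ} {P : Query k} (e : Expr)
    (he : ∀ (n : ℕ) (G : SimpleGraph (Fin n)) (X : Set (Fin n)) (s : State), HasInput G X s →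
      (e.eval s ≠ 0 ↔ P n G X (s.tuple k))) : Tests P := by
  refine ⟨.assign 2 e, Polynomial.C (e.cost + 1), fun n G X s hs =>
    ⟨_, _, .assign 2 e s, by simp, rfl, fun y _ hy => by simp [State.setVar, hy], ?_⟩⟩
  rw [← he n G X s hs]
  simp [State.setVar]

theorem tests_eq {k : ℕ} (i j : Fin k) : Tests (k := k) fun _ _ _ x => x i = x j :=
  -- The sum of both truncated differences vanishes exactly for equal numbers.
  tests_expr (.sub (.const 1) (.add (.sub (.var (3 + i)) (.var (3 + j)))
    (.sub (.var (3 + j)) (.var (3 + i))))) fun n G X s _ => by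
      simp only [Expr.eval, State.tuple]
      omega

/-- Adjacency of the vertices with given numbers. -/
def adjAt {n : ℕ} (G : SimpleGraph (Fin n)) (i j : ℕ) : Prop :=
  ∃ u v : Fin n, (u : ℕ) = i ∧ (v : ℕ) = j ∧ G.Adj u v

/-- Membership of the vertex with a given number. -/
def memAt {n : ℕ} (X : Set (Fin n)) (i : ℕ) : Prop :=
  ∃ v : Fin n, (v : ℕ) = i ∧ v ∈ X

theorem tests_adj {k : ℕ} (i j : Fin k) : Tests (k := k) fun _ G _ x => adjAt G (x i) (x j) :=
  tests_expr (.get 0 (.var (3 + i)) (.var (3 + j))) fun n G X s hs => by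
    simp [Expr.eval, hs.2.1, inputState, State.tuple, adjAt]

theorem tests_mem {k : ℕ} (i : Fin k) : Tests (k := k) fun _ _ X x => memAt X (x i) :=
  tests_expr (.get 1 (.const 0) (.var (3 + i))) fun n G X s hs => by
    simp [Expr.eval, hs.2.2, inputState, State.tuple, memAt]

theorem Tests.not {k : ℕ} {P : Query k} (hP : Tests P) :
    Tests (k := k) fun n G X x => ¬ P n G X x := by
  obtain ⟨c, p, h⟩ := hP
  refine ⟨.seq c (.assign 2 (.sub (.const 1) (.var 2))), p + Polynomial.C 4,
    fun n G X s hs => ?_⟩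
  obtain ⟨t, s', hex, ht, harr, hvar, hres⟩ := h n G X s hs
  refine ⟨_, _, .seq hex (.assign 2 _ s'), by simp [Expr.cost]; omega, harr,
    fun y hy hy2 => by simp [State.setVar, hy2, hvar y hy hy2], ?_⟩
  simp only [State.setVar, Expr.eval, ← hres]
  simp only [if_true]
  omega

theorem Tests.and {k : ℕ} {P Q : Query k} (hP : Tests P) (hQ : Tests Q) :
    Tests (k := k) fun n G X x => P n G X x ∧ Q n G X x := by
  obtain ⟨c, p, h⟩ := hP
  obtain ⟨c', p', h'⟩ := hQ
  refine ⟨.seq c (.cond (.var 2) c' .skip), p + (p' + Polynomial.C 3), fun n G X s hs => ?_⟩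
  obtain ⟨t, s₁, hex, ht, harr, hvar, hres⟩ := h n G X s hs
  have hs₁ : HasInput G X s₁ := hs.of_eq (hvar 0 (by omega) (by omega)) (by rw [harr]) (by rw [harr])
  by_cases h2 : s₁.vars 2 = 0
  · refine ⟨_, s₁, .seq hex (.cond_false h2 (.skip s₁)), ?_, harr, hvar, ?_⟩
    · simp [Expr.cost]
      omega
    · simp [← hres, h2]
  · obtain ⟨t', s₂, hex', ht', harr', hvar', hres'⟩ := h' n G X s₁ hs₁
    refine ⟨_, s₂, .seq hex (.cond_true h2 hex'), ?_, harr'.trans harr,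
      fun y hy hy2 => (hvar' y hy hy2).trans (hvar y hy hy2), ?_⟩
    · simp [Expr.cost]
      omega
    · rw [hres', State.tuple_congr hvar]
      exact ⟨fun hq => ⟨hres.1 h2, hq⟩, fun hq => hq.2⟩

theorem Tests.congr {k : ℕ} {P Q : Query k} (hP : Tests P)
    (h : ∀ n G X x, P n G X x ↔ Q n G X x) : Tests Q := by
  have : P = Q := by
    funext n G X x
    exact propext (h n G X x)
  exact this ▸ hP

theorem Tests.or {k : ℕ} {P Q : Query k} (hP : Tests P) (hQ : Tests Q) :
    Tests (k := k) fun n G X x => P n G X x ∨ Q n G X x :=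
  (hP.not.and hQ.not).not.congr fun n G X x => by tauto

/-- The loop counter occupies variable `3 + k`, the last coordinate of the extended tuple. Once
variable `2` is nonzero the body skips the test, so a success is never overwritten. -/
theorem Tests.exists {k : ℕ}
    {P : ∀ n : ℕ, SimpleGraph (Fin n) → Set (Fin n) → (Fin k → ℕ) → ℕ → Prop}
    (hP : Tests (k := k + 1) fun n G X x => P n G X (fun i => x i.castSucc) (x (Fin.last k))) :
    Tests (k := k) fun n G X x => ∃ y < n, P n G X x y := by
  obtain ⟨c, p, h⟩ := hP
  refine ⟨.seq (.assign (3 + k) (.const 0)) (.seq (.assign 2 (.const 0))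
    (.loop (.sub (.var 0) (.var (3 + k)))
      (.seq (.cond (.var 2) .skip c) (.assign (3 + k) (.add (.var (3 + k)) (.const 1)))))),
    Polynomial.C 4 + (Polynomial.X * (p + Polynomial.C 11) + Polynomial.C 4),
    fun n G X s hs => ?_⟩
  let I : ℕ → State → Prop := fun i s' => s'.arrs = s.arrs ∧
    (∀ y < 3 + k, y ≠ 2 → s'.vars y = s.vars y) ∧ s'.vars (3 + k) = i ∧
    (s'.vars 2 ≠ 0 ↔ ∃ y < i, P n G X (s.tuple k) y)
  have hloop := exec_loop (e := .sub (.var 0) (.var (3 + k)))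
    (c := .seq (.cond (.var 2) .skip c) (.assign (3 + k) (.add (.var (3 + k)) (.const 1))))
    (T := p.eval n + 7) (N := n) I ?_ ?_
    (s := (s.setVar (3 + k) 0).setVar 2 0) ?_
  · obtain ⟨t, s', hex, ht, harr, hvar, -, hres⟩ := hloop
    refine ⟨_, s', .seq (.assign _ _ s) (.seq (.assign _ _ _) hex), ?_, harr, hvar, hres⟩
    simp only [Expr.cost] at ht ⊢
    simp only [Polynomial.eval_add, Polynomial.eval_mul, Polynomial.eval_X, Polynomial.eval_C]
    have : 1 + 1 + 1 + 1 + (p.eval n + 7) = p.eval n + 11 := by omega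
    rw [this] at ht
    omega
  · rintro i hi s₁ ⟨harr, hvar, hx, hres⟩
    have h0 : s₁.vars 0 = n := (hvar 0 (by omega) (by omega)).trans hs.1
    refine ⟨by simp only [Expr.eval, h0, hx]; omega, ?_⟩
    have hs₁ : HasInput G X s₁ :=
      hs.of_eq (hvar 0 (by omega) (by omega)) (by rw [harr]) (by rw [harr])
    have htup : s₁.tuple k = s.tuple k := State.tuple_congr hvar
    by_cases h2 : s₁.vars 2 = 0
    · obtain ⟨t, s₂, hex, ht, harr', hvar', hres'⟩ := h n G X s₁ hs₁
      refine ⟨_, _, .seq (.cond_false h2 hex) (.assign _ _ s₂), by simp [Expr.cost]; omega,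
        harr'.trans harr, ?_, ?_, ?_⟩
      · intro y hy hy2
        simp [State.setVar, hy.ne, (hvar' y (by omega) hy2).trans (hvar y hy hy2)]
      · simp [State.setVar, Expr.eval, hvar' (3 + k) (by omega) (by omega), hx]
      · have hk : (2 : ℕ) ≠ 3 + k := by omega
        change _ ↔ P n G X (s₁.tuple k) (s₁.vars (3 + k)) at hres'
        simp only [State.setVar, hk, if_false]
        rw [hres', htup, hx]
        have hno : ¬ ∃ y < i, P n G X (s.tuple k) y := by
          rw [← hres]
          simp [h2]
        constructor
        · exact fun hp => ⟨i, by omega, hp⟩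
        · rintro ⟨y, hy, hp⟩
          rcases (Nat.lt_succ_iff.1 hy).lt_or_eq with hlt | rfl
          · exact absurd ⟨y, hlt, hp⟩ hno
          · exact hp
    · refine ⟨_, _, .seq (.cond_true h2 (.skip s₁)) (.assign _ _ s₁), by simp [Expr.cost],
        harr, ?_, ?_, ?_⟩
      · intro y hy hy2
        simp [State.setVar, hy.ne, hvar y hy hy2]
      · simp [State.setVar, Expr.eval, hx]
      · have hk : (2 : ℕ) ≠ 3 + k := by omega
        simp only [State.setVar, hk, if_false]
        obtain ⟨y, hy, hp⟩ := hres.1 h2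
        exact ⟨fun _ => ⟨y, by omega, hp⟩, fun _ => h2⟩
  · rintro s₁ ⟨harr, hvar, hx, hres⟩
    have h0 : s₁.vars 0 = n := (hvar 0 (by omega) (by omega)).trans hs.1
    simp [Expr.eval, h0, hx]
  · refine ⟨rfl, ?_, ?_, ?_⟩
    · intro y hy hy2
      simp [State.setVar, hy2, hy.ne]
    · simp [State.setVar]
    · simp [State.setVar]

/-! ### Programs that list families of vertex sets -/

/-- Some program appends, in polynomial time, at most polynomially many rows to the output; these
rows include all the sets `Y` that satisfy `Q`. -/
def Lists {k : ℕ} (Q : ∀ n : ℕ, SimpleGraph (Fin n) → Set (Fin n) → (Fin k → ℕ) →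
    Set (Fin n) → Prop) : Prop :=
  ∃ (c : Prog) (p : Polynomial ℕ), ∀ (n : ℕ) (G : SimpleGraph (Fin n)) (X : Set (Fin n))
    (s : State), HasInput G X s → ∃ t s', Exec c s t s' ∧ t ≤ p.eval n ∧ HasInput G X s' ∧
      (∀ y < 3 + k, y ≠ 1 → y ≠ 2 → s'.vars y = s.vars y) ∧
      s.vars 1 ≤ s'.vars 1 ∧ s'.vars 1 ≤ s.vars 1 + p.eval n ∧
      (∀ i < s.vars 1, s'.arrs 2 i = s.arrs 2 i) ∧
      ∀ Y, Q n G X (s.tuple k) Y →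
        ∃ i, s.vars 1 ≤ i ∧ i < s'.vars 1 ∧ Y = {v : Fin n | s'.arrs 2 i v ≠ 0}

/-- One row is filled vertex by vertex; the output length, which is the index of that row, grows
only after the row is complete. -/
theorem Tests.lists {k : ℕ}
    {P : ∀ n : ℕ, SimpleGraph (Fin n) → Set (Fin n) → (Fin k → ℕ) → ℕ → Prop}
    (hP : Tests (k := k + 1) fun n G X x => P n G X (fun i => x i.castSucc) (x (Fin.last k))) :
    Lists (k := k) fun n G X x Y => Y = {v : Fin n | P n G X x v} := by
  obtain ⟨c, p, h⟩ := hP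
  refine ⟨.seq (.assign (3 + k) (.const 0))
    (.seq (.loop (.sub (.var 0) (.var (3 + k)))
      (.seq c (.seq (.put 2 (.var 1) (.var (3 + k)) (.var 2))
        (.assign (3 + k) (.add (.var (3 + k)) (.const 1))))))
      (.assign 1 (.add (.var 1) (.const 1)))),
    Polynomial.X * (p + Polynomial.C 12) + Polynomial.C 10,
    fun n G X s hs => ?_⟩
  let I : ℕ → State → Prop := fun i s' => HasInput G X s' ∧
    (∀ y < 3 + k, y ≠ 2 → s'.vars y = s.vars y) ∧ s'.vars (3 + k) = i ∧
    (∀ j < s.vars 1, s'.arrs 2 j = s.arrs 2 j) ∧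
    ∀ y < i, (s'.arrs 2 (s.vars 1) y ≠ 0 ↔ P n G X (s.tuple k) y)
  have hloop := exec_loop (e := .sub (.var 0) (.var (3 + k)))
    (c := .seq c (.seq (.put 2 (.var 1) (.var (3 + k)) (.var 2))
        (.assign (3 + k) (.add (.var (3 + k)) (.const 1)))))
    (T := p.eval n + 8) (N := n) I ?_ ?_
    (s := s.setVar (3 + k) 0) ?_
  · obtain ⟨t, s', hex, ht, hin, hvar, -, hold, hnew⟩ := hloop
    refine ⟨_, _, .seq (.assign _ _ s) (.seq hex (.assign _ _ s')), ?_, ?_, ?_, ?_, ?_, ?_, ?_⟩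
    · simp only [Expr.cost] at ht ⊢
      simp only [Polynomial.eval_add, Polynomial.eval_mul, Polynomial.eval_X, Polynomial.eval_C]
      have : 1 + 1 + 1 + 1 + (p.eval n + 8) = p.eval n + 12 := by omega
      rw [this] at ht
      omega
    · exact hin.of_eq (by simp [State.setVar]) rfl rfl
    · intro y hy hy1 hy2
      simp [State.setVar, hy1, hvar y hy hy2]
    · simp [State.setVar, Expr.eval, hvar 1 (by omega) (by omega)]
    · simp [State.setVar, Expr.eval, hvar 1 (by omega) (by omega)]
    · exact hold
    · rintro Y rfl
      refine ⟨s.vars 1, le_rfl, by simp [State.setVar, Expr.eval, hvar 1 (by omega) (by omega)], ?_⟩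
      ext v
      exact (hnew v v.2).symm
  · rintro i hi s₁ ⟨hin, hvar, hx, hold, hnew⟩
    have h0 : s₁.vars 0 = n := hin.1
    refine ⟨by simp only [Expr.eval, h0, hx]; omega, ?_⟩
    obtain ⟨t, s₂, hex, ht, harr', hvar', hres'⟩ := h n G X s₁ hin
    have htup : s₁.tuple k = s.tuple k := State.tuple_congr hvar
    change _ ↔ P n G X (s₁.tuple k) (s₁.vars (3 + k)) at hres'
    rw [htup, hx] at hres'
    have hx₂ : s₂.vars (3 + k) = i := (hvar' _ (by omega) (by omega)).trans hx
    have h1 : s₂.vars 1 = s.vars 1 :=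
      (hvar' _ (by omega) (by omega)).trans (hvar _ (by omega) (by omega))
    refine ⟨_, _, .seq hex (.seq (.put _ _ _ _ _) (.assign _ _ _)), by simp [Expr.cost]; omega,
      ?_, ?_, ?_, ?_, ?_⟩
    · refine hin.of_eq ?_ ?_ ?_
      · have : (0 : ℕ) ≠ 3 + k := by omega
        simp [State.setVar, State.setArr, this, hvar' 0 (by omega) (by omega)]
      · simp [State.setVar, State.setArr, harr']
      · simp [State.setVar, State.setArr, harr']
    · intro y hy hy2
      simp [State.setVar, State.setArr, hy.ne, (hvar' y (by omega) hy2).trans (hvar y hy hy2)]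
    · simp [State.setVar, State.setArr, Expr.eval, hx₂]
    · intro j hj
      funext y
      simp [State.setVar, State.setArr, Expr.eval, h1, hj.ne, harr', hold j hj]
    · intro y hy
      simp only [State.setVar, State.setArr, Expr.eval, h1, hx₂, true_and]
      by_cases hyi : y = i
      · rw [if_pos hyi, hres', hyi]
      · rw [if_neg hyi, harr']
        exact hnew y (by omega)
  · rintro s₁ ⟨hin, hvar, hx, -⟩
    simp [Expr.eval, hin.1, hx]
  · refine ⟨hs.of_eq (by simp [State.setVar]; omega) rfl rfl, ?_, ?_, ?_, ?_⟩
    · intro y hy hy2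
      simp [State.setVar, hy.ne]
    · simp [State.setVar]
    · intro j _
      rfl
    · simp

/-- Every round only appends rows, so the sets listed for earlier values of the counter survive, and
both the time and the number of rows grow by at most a polynomial in each of the `n` rounds. -/
theorem Lists.exists {k : ℕ}
    {Q : ∀ n : ℕ, SimpleGraph (Fin n) → Set (Fin n) → (Fin k → ℕ) → ℕ → Set (Fin n) → Prop}
    (hQ : Lists (k := k + 1) fun n G X x => Q n G X (fun i => x i.castSucc) (x (Fin.last k))) :
    Lists (k := k) fun n G X x Y => ∃ y < n, Q n G X x y Y := by
  obtain ⟨c, p, h⟩ := hQ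
  refine ⟨.seq (.assign (3 + k) (.const 0))
    (.loop (.sub (.var 0) (.var (3 + k)))
      (.seq c (.assign (3 + k) (.add (.var (3 + k)) (.const 1))))),
    Polynomial.X * (p + Polynomial.C 8) + Polynomial.C 6,
    fun n G X s hs => ?_⟩
  let I : ℕ → State → Prop := fun i s' => HasInput G X s' ∧
    (∀ y < 3 + k, y ≠ 1 → y ≠ 2 → s'.vars y = s.vars y) ∧ s'.vars (3 + k) = i ∧
    s.vars 1 ≤ s'.vars 1 ∧ s'.vars 1 ≤ s.vars 1 + i * p.eval n ∧
    (∀ j < s.vars 1, s'.arrs 2 j = s.arrs 2 j) ∧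
    ∀ Y, (∃ y < i, Q n G X (s.tuple k) y Y) →
      ∃ j, s.vars 1 ≤ j ∧ j < s'.vars 1 ∧ Y = {v : Fin n | s'.arrs 2 j v ≠ 0}
  have hloop := exec_loop (e := .sub (.var 0) (.var (3 + k)))
    (c := .seq c (.assign (3 + k) (.add (.var (3 + k)) (.const 1))))
    (T := p.eval n + 4) (N := n) I ?_ ?_
    (s := s.setVar (3 + k) 0) ?_
  · obtain ⟨t, s', hex, ht, hin, hvar, -, hle, hle', hold, hnew⟩ := hloop
    refine ⟨_, s', .seq (.assign _ _ s) hex, ?_, hin, hvar, hle, hle'.trans ?_, hold, hnew⟩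
    · simp only [Expr.cost] at ht ⊢
      simp only [Polynomial.eval_add, Polynomial.eval_mul, Polynomial.eval_X, Polynomial.eval_C]
      have : 1 + 1 + 1 + 1 + (p.eval n + 4) = p.eval n + 8 := by omega
      rw [this] at ht
      omega
    · simp only [Polynomial.eval_add, Polynomial.eval_mul, Polynomial.eval_X, Polynomial.eval_C]
      rw [Nat.mul_add]
      omega
  · rintro i hi s₁ ⟨hin, hvar, hx, hle, hle', hold, hnew⟩
    refine ⟨by simp only [Expr.eval, hin.1, hx]; omega, ?_⟩
    obtain ⟨t, s₂, hex, ht, hin₂, hvar₂, hle₂, hle₂', hold₂, hnew₂⟩ := h n G X s₁ hin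
    have htup : s₁.tuple k = s.tuple k :=
      funext fun j => hvar _ (by omega) (by omega) (by omega)
    change ∀ Y, Q n G X (s₁.tuple k) (s₁.vars (3 + k)) Y → _ at hnew₂
    rw [htup, hx] at hnew₂
    have hx₂ : s₂.vars (3 + k) = i := (hvar₂ _ (by omega) (by omega) (by omega)).trans hx
    have hk : (1 : ℕ) ≠ 3 + k := by omega
    refine ⟨_, _, .seq hex (.assign _ _ _), by simp [Expr.cost]; omega, ?_, ?_, ?_, ?_, ?_, ?_, ?_⟩
    · refine hin₂.of_eq ?_ rfl rfl
      have : (0 : ℕ) ≠ 3 + k := by omega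
      simp [State.setVar, this]
    · intro y hy hy1 hy2
      simp [State.setVar, hy.ne, (hvar₂ y (by omega) hy1 hy2).trans (hvar y hy hy1 hy2)]
    · simp [State.setVar, Expr.eval, hx₂]
    · simp only [State.setVar, hk, if_false]
      omega
    · simp only [State.setVar, hk, if_false]
      rw [Nat.succ_mul]
      omega
    · intro j hj
      exact (hold₂ j (by omega)).trans (hold j hj)
    · rintro Y ⟨y, hy, hQ⟩
      simp only [State.setVar, hk, if_false]
      rcases (Nat.lt_succ_iff.1 hy).lt_or_eq with hlt | rfl
      · obtain ⟨j, hj, hj', hY⟩ := hnew Y ⟨y, hlt, hQ⟩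
        exact ⟨j, hj, by omega, by rw [hY, hold₂ j hj']⟩
      · obtain ⟨j, hj, hj', hY⟩ := hnew₂ Y hQ
        exact ⟨j, by omega, hj', hY⟩
  · rintro s₁ ⟨hin, hvar, hx, -⟩
    simp [Expr.eval, hin.1, hx]
  · have hk : (1 : ℕ) ≠ 3 + k := by omega
    refine ⟨hs.of_eq (by simp [State.setVar]; omega) rfl rfl, ?_, ?_, ?_, ?_, ?_, ?_⟩
    · intro y hy _ _
      simp [State.setVar, hy.ne]
    · simp [State.setVar]
    · simp [State.setVar, hk]
    · simp [State.setVar, hk]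
    · intro j _
      rfl
    · simp

end Carving

namespace Carving

/-! ### The algorithm -/

section Numbers

variable {n : ℕ} (G : SimpleGraph (Fin n)) (X : Set (Fin n))

/-- `Step G Xᶜ` in terms of numbers of vertices. -/
def stepAt (i j : ℕ) : Prop :=
  ¬ memAt X i ∧ ¬ memAt X j ∧ (i = j ∨ adjAt G i j)

/-- `Near G Xᶜ` in terms of numbers of vertices. -/
def nearAt (i j : ℕ) : Prop :=
  ∃ w₁ < n, ∃ w₂ < n, ∃ w₃ < n,
    stepAt G X i w₁ ∧ stepAt G X w₁ w₂ ∧ stepAt G X w₂ w₃ ∧ stepAt G X w₃ j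

/-- Membership in `candidate` in terms of numbers of vertices. -/
def candidateAt (a a' p q b e₁ e₂ v : ℕ) : Prop :=
  memAt X v ∨ ((adjAt G v a ∨ adjAt G v a') ∧ (adjAt G v p ∨ adjAt G v b)) ∨
    ((¬ e₁ = a ∧ nearAt G X e₁ v ∨ ¬ e₂ = a ∧ nearAt G X e₂ v) ∧
      (adjAt G v a ∨ adjAt G v p ∨ adjAt G v q))

variable {G X}

theorem memAt_val {v : Fin n} : memAt X v ↔ v ∈ X := by
  simp [memAt, Fin.val_inj]

theorem adjAt_val {u v : Fin n} : adjAt G u v ↔ G.Adj u v := by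
  simp [adjAt, Fin.val_inj]

theorem stepAt_val {u v : Fin n} : stepAt G X u v ↔ Step G Xᶜ u v := by
  simp [stepAt, Step, memAt_val, adjAt_val, Fin.val_inj]

theorem nearAt_val {u v : Fin n} : nearAt G X u v ↔ Near G Xᶜ u v := by
  constructor
  · rintro ⟨w₁, h₁, w₂, h₂, w₃, h₃, h⟩
    lift w₁ to Fin n using h₁
    lift w₂ to Fin n using h₂
    lift w₃ to Fin n using h₃
    simp only [stepAt_val] at h
    exact ⟨w₁, w₂, w₃, h⟩
  · rintro ⟨w₁, w₂, w₃, h⟩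
    simp only [← stepAt_val] at h
    exact ⟨w₁, w₁.2, w₂, w₂.2, w₃, w₃.2, h⟩

theorem candidateAt_val {a a' p q b e₁ e₂ v : Fin n} :
    candidateAt G X a a' p q b e₁ e₂ v ↔ v ∈ candidate G X a a' p q b e₁ e₂ := by
  simp [candidateAt, candidate, memAt_val, adjAt_val, nearAt_val, Fin.val_inj]

end Numbers

theorem tests_step {k : ℕ} (i j : Fin k) :
    Tests (k := k) fun _ G X x => stepAt G X (x i) (x j) :=
  (tests_mem i).not.and ((tests_mem j).not.and ((tests_eq i j).or (tests_adj i j)))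

theorem tests_near {k : ℕ} (i j : Fin k) :
    Tests (k := k) fun _ G X x => nearAt G X (x i) (x j) := by
  refine Tests.exists (Tests.exists (Tests.exists ?_))
  exact (tests_step i.castSucc.castSucc.castSucc (Fin.last k).castSucc.castSucc).and
    ((tests_step (Fin.last k).castSucc.castSucc (Fin.last (k + 1)).castSucc).and
      ((tests_step (Fin.last (k + 1)).castSucc (Fin.last (k + 2))).and
        (tests_step (Fin.last (k + 2)) j.castSucc.castSucc.castSucc)))

/-- Coordinates `0` to `6` are `a, a', p, q, b, e₁, e₂`; coordinate `7` is the vertex tested for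
membership. -/
theorem tests_candidate : Tests (k := 8) fun _ G X x =>
    candidateAt G X (x 0) (x 1) (x 2) (x 3) (x 4) (x 5) (x 6) (x 7) :=
  (tests_mem 7).or ((((tests_adj 7 0).or (tests_adj 7 1)).and
    ((tests_adj 7 2).or (tests_adj 7 4))).or
    ((((tests_eq 5 0).not.and (tests_near 5 7)).or ((tests_eq 6 0).not.and (tests_near 6 7))).and
      ((tests_adj 7 0).or ((tests_adj 7 2).or (tests_adj 7 3)))))

theorem lists_candidates : Lists (k := 0) fun n G X _ Y =>
    ∃ a < n, ∃ a' < n, ∃ p < n, ∃ q < n, ∃ b < n, ∃ e₁ < n, ∃ e₂ < n,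
      Y = {v : Fin n | candidateAt G X a a' p q b e₁ e₂ v} := by
  refine Lists.exists (Lists.exists (Lists.exists (Lists.exists (Lists.exists
    (Lists.exists (Lists.exists (Tests.lists ?_)))))))
  exact tests_candidate

end Carving

theorem mainTheorem7 (d : ℕ) (hd : 0 < d) :
    ∃ (prog : Carving.Prog) (p : Polynomial ℕ),
      ∀ (n : ℕ) (G : SimpleGraph (Fin n)), Carving.IsP6Free G →
      ∀ Stilde : Set (Fin n),
        ∃ (t : ℕ) (s : Carving.State),
          Carving.Exec prog (Carving.inputState G Stilde) t s ∧
          t ≤ p.eval n ∧ Carving.outputLength s ≤ p.eval n ∧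
          ∀ T : Carving.RootedForest (Fin n), T.IsMaximalTreedepthStructure G d →
          ∀ S : Set (Fin n), Carving.IsMixed G S → Carving.IsAvoiding T d S →
            ∃ S' ∈ Carving.outputFamily n s,
              Stilde ⊆ S' ∧
              S' ∩ T.verts ⊆ S ∪ Stilde ∧
              ∀ Dtilde : Set (Fin n), Carving.IsClarified G S Stilde Dtilde →
              ∀ C : Set (Fin n), Carving.IsComponentIn G (Dtilde \ S') C →
              ∀ D₁ D₂ : Set (Fin n),
                Carving.IsComponentIn G Sᶜ D₁ → Carving.IsComponentIn G Sᶜ D₂ →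
                (C ∩ D₁).Nonempty → (C ∩ D₂).Nonempty → D₁ = D₂ := by
  obtain ⟨prog, p, h⟩ := Carving.lists_candidates
  refine ⟨prog, p, fun n G hG X => ?_⟩
  obtain ⟨t, s, hex, ht, -, -, -, hlen, -, hout⟩ :=
    h n G X (Carving.inputState G X) ⟨by simp [Carving.inputState], rfl, rfl⟩
  -- The output length is `0` initially, so the bound on appended rows bounds the whole output.
  refine ⟨t, s, hex, ht, by simpa [Carving.inputState, Carving.outputLength] using hlen,
    fun T _ S hS _ => ?_⟩
  obtain ⟨a, a', p, q, b, e₁, e₂, hsub, hsep⟩ := hG.exists_candidate X hS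
  obtain ⟨i, -, hi, hY⟩ := hout (Carving.candidate G X a a' p q b e₁ e₂)
    ⟨a, a.2, a', a'.2, p, p.2, q, q.2, b, b.2, e₁, e₁.2, e₂, e₂.2, by
      ext v
      exact Carving.candidateAt_val.symm⟩
  exact ⟨_, ⟨i, hi, hY⟩, fun v hv => .inl hv, fun v hv => hsub hv.1, hsep⟩
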